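/- Let $\Bbbk$ be $\mathbb{Z}$ or a prime field (more generally, any commutative ring). Let $\mathbf{gr}$ be the category of free groups of finite rank and all group homomorphisms, $T*A$ the free product, and $u(A,T)\colon A\to T*A$ the canonical inclusion. Let $\mathfrak{a}\colon\mathbf{gr}\to\Bbbk\text{-}\mathbf{Mod}$ be the functor $G\mapsto \Bbbk\otimes_{\mathbb{Z}}G_{\mathrm{ab}}$ and, for $r\in\mathbb{N}$, let $P_r=\Bbbk[\mathbf{gr}(\mathbb{Z}^{*r},-)]$; tensor products of functors $\mathbf{gr}\to\Bbbk\text{-}\mathbf{Mod}$ are taken pointwise over $\Bbbk$. For $X\colon\mathbf{gr}^{op}\to\Bbbk\text{-}\mathbf{Mod}$, let $\mathrm{Tor}^{\mathbf{gr}}_*(X,-)$ be the left derived functors of $X\otimes_{\mathbf{gr}}-$, where $X\otimes_{\mathbf{gr}}F$ is the quotient of $\bigoplus_{A}X(A)\otimes_{\Bbbk} F(A)$ by the relations $X(f)(x)\otimes y=x\otimes F(f)(y)$ for $f\colon A\to B$, $x\in X(B)$, $y\in F(A)$. Let $X\colon\mathbf{gr}^{op}\to\Bbbk\text{-}\mathbf{Mod}$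 be a functor and suppose that for all objects $A,T$ of $\mathbf{gr}$ there is a $\Bbbk$-linear map $\xi(A,T)\colon X(A)\to X(T*A)$ such that: 1. for all $\varphi\colon A\to B$ and $T$ in $\mathbf{gr}$, $\ \xi(A,T)\circ X(\varphi)=X(T*\varphi)\circ\xi(B,T)$ as maps $X(B)\to X(T*A)$; 2. for all $A,T$ in $\mathbf{gr}$, $\ X(u(A,T))\circ\xi(A,T)=\mathrm{Id}_{X(A)}$; 3. for all $\varphi\colon A\to B$ and $\tau\colon T\to T*B$ in $\mathbf{gr}$ such that the endomorphism $\theta$ of $T*B$ equal to $\tau$ on $T$ and to the canonical inclusion on $B$ is an isomorphism, $\ \xi(A,T)\circ X(\varphi)=X(\psi)\circ\xi(B,T)$, where $\psi\colon T*A\to T*B$ is the morphism equal to $\tau$ on $T$ and to $u(B,T)\circ\varphi$ on $A$. Then $\mathrm{Tor}^{\mathbf{gr}}_i(X,\mathfrak{a}\otimes P_r)=0$ for all $i,r\in\mathbb{N}$. -/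

import Mathlib

open CategoryTheory MonoidalCategory Opposite
open scoped TensorProduct DirectSum

universe u v

noncomputable section

/-! ### The tensor product of functors over a category -/

namespace FunctorTensor

variable {k : Type} [CommRing k] {C : Type u} [Category.{v} C]

open Classical in
/-- The submodule of `⨁ A, X(A) ⊗ F(A)` spanned by the elements
`X(f)(x) ⊗ y - x ⊗ F(f)(y)` for `f : A ⟶ B`, `x ∈ X(B)`, `y ∈ F(A)`. -/
def relations (X : Cᵒᵖ ⥤ ModuleCat.{0} k) (F : C ⥤ ModuleCat.{0} k) :
    Submodule k (⨁ A : C, X.obj (op A) ⊗[k] F.obj A) :=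
  Submodule.span k {z | ∃ (A B : C) (f : A ⟶ B) (x : X.obj (op B)) (y : F.obj A),
    z = DirectSum.lof k C (fun A => X.obj (op A) ⊗[k] F.obj A) A (X.map f.op x ⊗ₜ[k] y) -
      DirectSum.lof k C (fun A => X.obj (op A) ⊗[k] F.obj A) B (x ⊗ₜ[k] F.map f y)}

/-- The underlying module of `X ⊗_C F`: the coend of `(A, B) ↦ X(A) ⊗ F(B)`. -/
abbrev tensorModule (X : Cᵒᵖ ⥤ ModuleCat.{0} k) (F : C ⥤ ModuleCat.{0} k) : Type u :=
  (⨁ A : C, X.obj (op A) ⊗[k] F.obj A) ⧸ relations X F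

/-- The map `⨁ A, X(A) ⊗ F(A) → ⨁ A, X(A) ⊗ G(A)` induced by `α : F ⟶ G`. -/
def sumMap (X : Cᵒᵖ ⥤ ModuleCat.{0} k) {F G : C ⥤ ModuleCat.{0} k} (α : F ⟶ G) :
    (⨁ A : C, X.obj (op A) ⊗[k] F.obj A) →ₗ[k] ⨁ A : C, X.obj (op A) ⊗[k] G.obj A :=
  DirectSum.lmap fun A => (α.app A).hom.lTensor (X.obj (op A))

theorem relations_le (X : Cᵒᵖ ⥤ ModuleCat.{0} k) {F G : C ⥤ ModuleCat.{0} k} (α : F ⟶ G) :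
    relations X F ≤ (relations X G).comap (sumMap X α) := by
  classical
  refine Submodule.span_le.2 ?_
  rintro _ ⟨A, B, f, x, y, rfl⟩
  refine Submodule.subset_span ⟨A, B, f, x, α.app A y, ?_⟩
  have h : α.app B (F.map f y) = G.map f (α.app A y) :=
    ConcreteCategory.congr_hom (α.naturality f) y
  rw [← h]
  simp only [sumMap, map_sub, DirectSum.lmap_lof, LinearMap.lTensor_tmul]

/-- The functor `X ⊗_C - : Fct(C, k-Mod) ⥤ k-Mod`. The direct sum over all objects of `C` lives
in the universe of the objects of `C`, hence so does the value. -/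
def tensorFunctor (X : Cᵒᵖ ⥤ ModuleCat.{0} k) : (C ⥤ ModuleCat.{0} k) ⥤ ModuleCat.{u} k where
  obj F := ModuleCat.of k (tensorModule X F)
  map {F G} α := ModuleCat.ofHom
    ((relations X F).mapQ (relations X G) (sumMap X α) (relations_le X α))
  map_id F := by
    classical
    ext : 1
    refine Submodule.linearMap_qext _ (DirectSum.linearMap_ext _ fun A => ?_)
    ext
    simp [sumMap]
  map_comp α β := by
    classical
    ext : 1
    refine Submodule.linearMap_qext _ (DirectSum.linearMap_ext _ fun A => ?_)
    ext
    simp [sumMap, DirectSum.lmap_lof]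

instance (X : Cᵒᵖ ⥤ ModuleCat.{0} k) : (tensorFunctor X).Additive where
  map_add {F G α β} := by
    classical
    ext : 1
    refine Submodule.linearMap_qext _ (DirectSum.linearMap_ext _ fun A => ?_)
    refine TensorProduct.ext' fun x y => ?_
    let z : ⨁ A : C, X.obj (op A) ⊗[k] F.obj A := DirectSum.lof k C _ A (x ⊗ₜ[k] y)
    change (relations X G).mkQ (sumMap X (α + β) z) =
      (relations X G).mkQ (sumMap X α z) + (relations X G).mkQ (sumMap X β z)
    rw [← map_add]
    congr 1
    simp [z, sumMap, DirectSum.lmap_lof]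

/-- `Tor_i^C(X, F)`: the `i`-th left derived functor of `X ⊗_C -`, evaluated at `F`. -/
def Tor [HasProjectiveResolutions (C ⥤ ModuleCat.{0} k)] (i : ℕ)
    (X : Cᵒᵖ ⥤ ModuleCat.{0} k) (F : C ⥤ ModuleCat.{0} k) : ModuleCat.{u} k :=
  ((tensorFunctor X).leftDerived i).obj F

/-- The standard projective `P_c = k[C(c, -)]`. -/
def stdProj {C : Type u} [Category.{0} C] (k : Type) [CommRing k] (c : C) :
    C ⥤ ModuleCat.{0} k :=
  coyoneda.obj (op c) ⋙ ModuleCat.free k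

/-- The basis element of `P_c(A)` given by a morphism `f : c ⟶ A`. -/
def stdProjMk {C : Type u} [Category.{0} C] (k : Type) [CommRing k] {c A : C} (f : c ⟶ A) :
    (stdProj k c).obj A :=
  ModuleCat.freeMk (X := c ⟶ A) f

theorem stdProj_map_mk {C : Type u} [Category.{0} C] {c A B : C} (f : c ⟶ A) (g : A ⟶ B) :
    (stdProj k c).map g (stdProjMk k f) = stdProjMk k (f ≫ g) :=
  ModuleCat.free_map_apply (R := k) ((coyoneda.obj (op c)).map g) f

theorem stdProj_hom_ext {C : Type u} [Category.{0} C] {c A : C} {M : ModuleCat.{0} k}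
    {f g : (stdProj k c).obj A ⟶ M} (h : ∀ a : c ⟶ A, f (stdProjMk k a) = g (stdProjMk k a)) :
    f = g :=
  ModuleCat.free_hom_ext h

/-- The linear map `P_c(A) ⟶ M` with prescribed values on the basis. -/
def stdProjLift {C : Type u} [Category.{0} C] {c A : C} {M : ModuleCat.{0} k}
    (f : (c ⟶ A) → M) : (stdProj k c).obj A ⟶ M :=
  ModuleCat.freeDesc (X := c ⟶ A) (↾f)

theorem stdProjLift_mk {C : Type u} [Category.{0} C] {c A : C} {M : ModuleCat.{0} k}
    (f : (c ⟶ A) → M) (a : c ⟶ A) : stdProjLift f (stdProjMk k a) = f a :=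
  ModuleCat.freeDesc_apply (X := c ⟶ A) _ _

/-- The morphism `P_c ⟶ F` classified by an element of `F(c)` (Yoneda). -/
def stdProjDesc {C : Type u} [Category.{0} C] {c : C} {F : C ⥤ ModuleCat.{0} k} (x : F.obj c) :
    stdProj k c ⟶ F where
  app A := stdProjLift fun f => F.map f x
  naturality A B g := by
    apply stdProj_hom_ext
    intro f
    rw [ConcreteCategory.comp_apply, ConcreteCategory.comp_apply, stdProj_map_mk,
      stdProjLift_mk, stdProjLift_mk, F.map_comp, ConcreteCategory.comp_apply]

theorem stdProjDesc_app {C : Type u} [Category.{0} C] {c : C} {F : C ⥤ ModuleCat.{0} k}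
    (x : F.obj c) {A : C} (f : c ⟶ A) :
    (stdProjDesc x).app A (stdProjMk k f) = F.map f x :=
  stdProjLift_mk _ f

instance {C : Type u} [Category.{0} C] (c : C) : Projective (stdProj k c) where
  factors {E Y} f e he := by
    have : Epi (e.app c) := inferInstance
    obtain ⟨x, hx⟩ := (ModuleCat.epi_iff_surjective (e.app c)).1 this
      (f.app c (stdProjMk k (𝟙 c)))
    refine ⟨stdProjDesc x, ?_⟩
    ext A : 2
    apply stdProj_hom_ext
    intro g
    have h1 := ConcreteCategory.congr_hom (e.naturality g) x
    have h2 := ConcreteCategory.congr_hom (f.naturality g) (stdProjMk k (𝟙 c))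
    rw [ConcreteCategory.comp_apply, ConcreteCategory.comp_apply] at h1 h2
    rw [stdProj_map_mk, Category.id_comp, ← hx] at h2
    rw [NatTrans.comp_app, ConcreteCategory.comp_apply, stdProjDesc_app, h1, h2]

end FunctorTensor

/-! ### The category of free groups of finite rank -/

/-- `G` is a free group of finite rank. -/
def finiteRankFree : ObjectProperty GrpCat.{0} :=
  fun G => ∃ n : ℕ, Nonempty (FreeGroupBasis (Fin n) G)

/-- `gr`: the full subcategory of the category of groups on the free groups of finite rank. -/
abbrev Gr : Type 1 := finiteRankFree.FullSubcategory

namespace Gr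

/-- The free group `ℤ^{*n}` on `n` generators. -/
def free (n : ℕ) : Gr := ⟨GrpCat.of (FreeGroup (Fin n)), n, ⟨FreeGroupBasis.ofFreeGroup _⟩⟩

/-- A group homomorphism, as a morphism of `gr`. -/
abbrev ofHom {A B : Gr} (f : A.obj →* B.obj) : A ⟶ B := ObjectProperty.homMk (GrpCat.ofHom f)

theorem finiteRankFree_coprod (A B : Gr) :
    finiteRankFree (GrpCat.of (Monoid.Coprod A.obj B.obj)) := by
  obtain ⟨m, ⟨a⟩⟩ := A.property
  obtain ⟨n, ⟨b⟩⟩ := B.property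
  refine ⟨m + n, ⟨FreeGroupBasis.reindex ?_ finSumFinEquiv⟩⟩
  refine FreeGroupBasis.ofRepr (MonoidHom.toMulEquiv
    (Monoid.Coprod.lift (a.lift fun i => FreeGroup.of (Sum.inl i))
      (b.lift fun i => FreeGroup.of (Sum.inr i)))
    (FreeGroup.lift (Sum.elim (fun i => Monoid.Coprod.inl (a i))
      (fun i => Monoid.Coprod.inr (b i)))) ?_ ?_)
  · apply Monoid.Coprod.hom_ext
    · apply a.ext_hom
      simp
    · apply b.ext_hom
      simp
  · ext i
    cases i <;> simp

/-- The free product `T * A`. -/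
def freeProd (T A : Gr) : Gr := ⟨GrpCat.of (Monoid.Coprod T.obj A.obj), finiteRankFree_coprod T A⟩

/-- The canonical inclusion `u(A, T) : A → T * A`. -/
def u (A T : Gr) : A ⟶ freeProd T A := ofHom (Monoid.Coprod.inr : A.obj →* Monoid.Coprod T.obj A.obj)

/-- The morphism `T * A → B` with components `f : T → B` and `g : A → B`. -/
def desc {T A B : Gr} (f : T ⟶ B) (g : A ⟶ B) : freeProd T A ⟶ B :=
  ofHom (A := freeProd T A) (Monoid.Coprod.lift f.hom.hom g.hom.hom)

/-- The morphism `T * φ : T * A → T * B`. -/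
def freeProdMap (T : Gr) {A B : Gr} (φ : A ⟶ B) : freeProd T A ⟶ freeProd T B :=
  ofHom (A := freeProd T A) (B := freeProd T B) (Monoid.Coprod.map (MonoidHom.id T.obj) φ.hom.hom)

open FunctorTensor in
instance (k : Type) [CommRing k] : EnoughProjectives (Gr ⥤ ModuleCat.{0} k) where
  presentation F := by
    let I := Σ n : ℕ, F.obj (free n)
    let P : I → (Gr ⥤ ModuleCat.{0} k) := fun s => stdProj k (free s.1)
    have : ∀ s, Projective (P s) := fun s => inferInstanceAs (Projective (stdProj k (free s.1)))
    let p : (∐ P) ⟶ F := Limits.Sigma.desc fun s => stdProjDesc s.2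
    have hP : Projective (∐ P) := ⟨fun f e _ =>
      ⟨Limits.Sigma.desc fun s => Projective.factorThru (Limits.Sigma.ι P s ≫ f) e, by cat_disch⟩⟩
    suffices hp : Epi p from ⟨{ p := ∐ P, f := p }⟩
    refine (NatTrans.epi_iff_epi_app p).2 ?_
    intro A
    rw [ModuleCat.epi_iff_surjective]
    intro y
    obtain ⟨n, ⟨b⟩⟩ := A.property
    let e : free n ≅ A := finiteRankFree.isoMk (b.repr.symm.toGrpIso)
    let s : I := ⟨n, F.map e.inv y⟩
    refine ⟨(Limits.Sigma.ι P s).app A (stdProjMk k e.hom), ?_⟩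
    have h1 : Limits.Sigma.ι P s ≫ p = stdProjDesc s.2 := by simp [p]
    have h2 := ConcreteCategory.congr_hom (congr_app h1 A) (stdProjMk k e.hom)
    rw [stdProjDesc_app, NatTrans.comp_app, ConcreteCategory.comp_apply] at h2
    erw [h2]
    simp only [s]
    rw [← ConcreteCategory.comp_apply, ← F.map_comp, e.inv_hom_id, F.map_id]
    rfl

/-- The abelianization functor tensored with `k`, `𝔞(G) = k ⊗_ℤ G_ab`. -/
def ab (k : Type) [CommRing k] : Gr ⥤ ModuleCat.{0} k where
  obj G := ModuleCat.of k (k ⊗[ℤ] Additive (Abelianization G.obj))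
  map f := ModuleCat.ofHom
    ((MonoidHom.toAdditive (Abelianization.map f.hom.hom)).toIntLinearMap.baseChange k)
  map_id G := by
    ext x
    change _ = (1 : k) ⊗ₜ[ℤ] x
    simp
  map_comp f g := by
    ext x
    simp

/-- The standard projective `P_r = k[gr(ℤ^{*r}, -)]`. -/
abbrev P (k : Type) [CommRing k] (r : ℕ) : Gr ⥤ ModuleCat.{0} k :=
  FunctorTensor.stdProj k (free r)

end Gr

end

noncomputable section

/-! The value at `G` of the standard projective on `ℤ^{*n} * A` is free on the tuples `(g₁, …, gₙ,
f)` with `f : A → G`. For varying `n` these are the bar chains of `G` with trivial coefficients in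
`P_A(G)`. As `G` is free, the homology is `𝔞(G) ⊗ P_A(G)` in degree one and zero above, and the
differential from degree one to degree zero vanishes. The faces come from morphisms of `gr`, so
deleting degree zero leaves a resolution of `𝔞 ⊗ P_A` by standard projectives (`barResolution`).
Exactness is objectwise, so it is enough to contract the complex at each `G` by a homotopy built
from a Fox derivative, which depends on a basis (`barD_barHomotopy`, `exists_barD_one_eq`).

By Yoneda, `X ⊗ -` turns the resolution into the complex of the `X(ℤ^{*n} * A)`, `n ≥ 1`, with faces
`dᵢ`. There `s = ξ(-, ℤ)` is an extra degeneracy: `d₀ s = id` by condition 2; `d₁ s = s d₀` by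
condition 3 for the automorphism `x ↦ x y` of `ℤ * (ℤ * A)`; and `dᵢ₊₁ s = s dᵢ` for `i ≥ 1` by
condition 1. Hence `d s + s d = id` (`coefHomotopy_coefD`). Since `d` vanishes on the term `n = 1`,
the truncated complex is acyclic down to its last term. -/

theorem Finsupp.lmapDomain_single_apply {k : Type*} [CommRing k] {α β : Type*} (f : α → β)
    (a : α) (c : k) :
    Finsupp.lmapDomain k k f (Finsupp.single a c) = Finsupp.single (f a) c :=
  Finsupp.mapDomain_single

/-! ### Crossed homomorphisms on free groups -/

namespace FreeGroupBasis

variable {ι G : Type*} [Group G]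

theorem induction_on (b : FreeGroupBasis ι G) {p : G → Prop} (one : p 1) (of : ∀ i, p (b i))
    (mul : ∀ x y, p x → p y → p (x * y)) (inv : ∀ x, p x → p x⁻¹) (g : G) : p g := by
  have key : ∀ w : FreeGroup ι, p (b.repr.symm w) := by
    intro w
    induction w using FreeGroup.induction_on with
    | C1 => simpa using one
    | of i => exact of i
    | inv_of i h => simpa using inv _ h
    | mul x y hx hy => simpa using mul _ _ hx hy
  simpa using key (b.repr g)

/-- On a free group there is a crossed homomorphism with prescribed values on a basis. -/
theorem exists_crossedHom {M : Type*} [AddCommGroup M] (b : FreeGroupBasis ι G)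
    (ρ : G →* Module.End ℤ M) (v : ι → M) :
    ∃ D : G → M, (∀ g h, D (g * h) = D g + ρ g (D h)) ∧ ∀ i, D (b i) = v i := by
  have hρ : ∀ g m, ρ g⁻¹ (ρ g m) = m := fun g m => by
    rw [← Module.End.mul_apply, ← map_mul, inv_mul_cancel, map_one, Module.End.one_apply]
  have hρ' : ∀ g m, ρ g (ρ g⁻¹ m) = m := fun g m => by
    rw [← Module.End.mul_apply, ← map_mul, mul_inv_cancel, map_one, Module.End.one_apply]
  -- A crossed homomorphism is the translation part of an action by affine maps. Freeness allows the
  -- affine maps attached to the basis to be chosen at will; `D g` is then the image of `0` under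
  -- `g`.
  let σ : G →* Equiv.Perm M := b.lift fun i =>
    { toFun := fun m => ρ (b i) m + v i
      invFun := fun m => ρ (b i)⁻¹ (m - v i)
      left_inv := fun m => by simp [hρ]
      right_inv := fun m => by simp [hρ'] }
  have hσ : ∀ g m, σ g m = ρ g m + σ g 0 := by
    intro g
    induction g using b.induction_on with
    | one => simp
    | of i => simp [σ]
    | mul x y hx hy =>
      intro m
      rw [map_mul, map_mul, Equiv.Perm.mul_apply, Equiv.Perm.mul_apply, hx (σ y m), hy m,
        hx (σ y 0), map_add, Module.End.mul_apply, add_assoc]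
    | inv x hx =>
      intro m
      apply (σ x).injective
      rw [hx (_ + _), map_add, hρ', add_assoc, ← hx, ← Equiv.Perm.mul_apply,
        ← Equiv.Perm.mul_apply, ← map_mul, mul_inv_cancel, map_one]
      simp
  refine ⟨fun g => σ g 0, fun g h => ?_, fun i => by simp [σ]⟩
  change σ (g * h) 0 = σ g 0 + ρ g (σ h 0)
  rw [map_mul, Equiv.Perm.mul_apply, hσ, add_comm]

/-- Two crossed homomorphisms that agree on a basis of a free group are equal. -/
theorem crossedHom_ext {M : Type*} [AddCommGroup M] (b : FreeGroupBasis ι G)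
    (ρ : G →* Module.End ℤ M) {D E : G → M} (hD : ∀ g h, D (g * h) = D g + ρ g (D h))
    (hE : ∀ g h, E (g * h) = E g + ρ g (E h)) (h : ∀ i, D (b i) = E (b i)) : D = E := by
  have one : ∀ {F : G → M}, (∀ g h, F (g * h) = F g + ρ g (F h)) → F 1 = 0 := by
    intro F hF
    simpa using hF 1 1
  have inv : ∀ {F : G → M}, (∀ g h, F (g * h) = F g + ρ g (F h)) →
      ∀ g, F g⁻¹ = - ρ g⁻¹ (F g) := by
    intro F hF g
    have := hF g⁻¹ g
    rw [inv_mul_cancel, one hF] at this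
    exact eq_neg_of_add_eq_zero_left this.symm
  funext g
  induction g using b.induction_on with
  | one => rw [one hD, one hE]
  | of i => exact h i
  | mul x y hx hy => rw [hD, hE, hx, hy]
  | inv x hx => rw [inv hD, inv hE, hx]

variable (k : Type*) [CommRing k]

/-- The universal Fox derivative `D`, with values in the free module on pairs `(w, x)`: it is a
crossed homomorphism for left translation of `w`, and the boundary `(w, x) ↦ w x - w` sends
`D g` to `g - 1`. -/
theorem exists_foxDerivative (b : FreeGroupBasis ι G) :
    ∃ D : G → (G × G →₀ k),
      (∀ g h, D (g * h) = D g + Finsupp.lmapDomain k k (Prod.map (g * ·) id) (D h)) ∧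
      ∀ g, Finsupp.lmapDomain k k (fun p : G × G => p.1 * p.2) (D g) -
        Finsupp.lmapDomain k k Prod.fst (D g) = Finsupp.single g 1 - Finsupp.single 1 1 := by
  let ρ : G →* Module.End ℤ (G × G →₀ k) :=
    { toFun := fun g => (Finsupp.lmapDomain k k (Prod.map (g * ·) id)).restrictScalars ℤ
      map_one' := by ext ⟨a, b⟩; simp
      map_mul' := fun g h => by
        ext ⟨a, b⟩
        simp [Finsupp.mapDomain_single, mul_assoc] }
  let ρ' : G →* Module.End ℤ (G →₀ k) :=
    { toFun := fun g => (Finsupp.lmapDomain k k (g * ·)).restrictScalars ℤ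
      map_one' := by ext; simp
      map_mul' := fun g h => by
        ext p
        simp [Finsupp.mapDomain_single, mul_assoc] }
  -- With `(w, x)` read as the edge from `w` to `w x` of the Cayley graph, `D (b i)` is the edge
  -- from `1` to `b i`, and `D g` is a path from `1` to `g`.
  obtain ⟨D, hD, hb⟩ := b.exists_crossedHom ρ fun i => Finsupp.single (1, b i) 1
  refine ⟨D, hD, fun g => ?_⟩
  let β : (G × G →₀ k) →ₗ[k] (G →₀ k) :=
    Finsupp.lmapDomain k k (fun p : G × G => p.1 * p.2) - Finsupp.lmapDomain k k Prod.fst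
  have hβ : ∀ g z, β (ρ g z) = ρ' g (β z) := by
    intro g z
    induction z using Finsupp.induction_linear with
    | zero => simp
    | add x y hx hy => rw [map_add, map_add, map_add, map_add, hx, hy]
    | single p c =>
      simp only [β, ρ, ρ', MonoidHom.coe_mk, OneHom.coe_mk, LinearMap.coe_restrictScalars,
        LinearMap.sub_apply, Finsupp.lmapDomain_single_apply, map_sub, Prod.map_fst, Prod.map_snd,
        id, mul_assoc]
  -- The boundary is equivariant, so both sides are crossed homomorphisms into `k[G]`, the right one
  -- principal; it remains to compare them on the basis.
  refine congr_fun (b.crossedHom_ext ρ' (D := fun g => β (D g))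
    (E := fun g => Finsupp.single g 1 - Finsupp.single 1 1) ?_ ?_ ?_) g
  · intro g h
    rw [hD, map_add, hβ]
  · intro g h
    simp only [ρ', MonoidHom.coe_mk, OneHom.coe_mk, LinearMap.coe_restrictScalars,
      Finsupp.lmapDomain_single_apply, map_sub, mul_one]
    abel
  · intro i
    simp [hb, β]

end FreeGroupBasis

/-! ### Iterated free products with `ℤ` -/

namespace Gr

/-- The morphism `ℤ → G` given by an element of `G`. -/
def point {G : Gr} (g : G.obj) : free 1 ⟶ G :=
  ofHom (A := free 1) (FreeGroup.lift fun _ : Fin 1 => g)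

/-- The morphism `ℤ * A → G` given by an element of `G` and a morphism `A → G`. -/
def cons {A G : Gr} (g : G.obj) (f : A ⟶ G) : freeProd (free 1) A ⟶ G := desc (point g) f

theorem hom_ext_apply {A B : Gr} {f g : A ⟶ B} (h : ∀ x, f.hom.hom x = g.hom.hom x) : f = g := by
  apply ObjectProperty.hom_ext
  apply GrpCat.hom_ext
  exact MonoidHom.ext h

/-- The generator of the factor `ℤ` of `ℤ * A`. -/
def gen (A : Gr) : (freeProd (free 1) A).obj :=
  (Monoid.Coprod.inl (FreeGroup.of (0 : Fin 1)) : Monoid.Coprod (FreeGroup (Fin 1)) A.obj)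

theorem cons_gen {A G : Gr} (g : G.obj) (f : A ⟶ G) : (cons g f).hom.hom (gen A) = g := by
  change Monoid.Coprod.lift _ _ (Monoid.Coprod.inl _) = g
  refine (Monoid.Coprod.lift_apply_inl _ _ _).trans ?_
  change FreeGroup.lift _ (FreeGroup.of _) = g
  simp

theorem u_comp_desc {T A G : Gr} (t : T ⟶ G) (f : A ⟶ G) : u A T ≫ desc t f = f := by
  refine hom_ext_apply fun x => ?_
  exact Monoid.Coprod.lift_apply_inr t.hom.hom f.hom.hom x

theorem u_comp_cons {A G : Gr} (g : G.obj) (f : A ⟶ G) : u A (free 1) ≫ cons g f = f :=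
  u_comp_desc _ _

theorem freeProd_hom_ext {A G : Gr} {f g : freeProd (free 1) A ⟶ G}
    (h : f.hom.hom (gen A) = g.hom.hom (gen A)) (h' : u A (free 1) ≫ f = u A (free 1) ≫ g) :
    f = g := by
  apply ObjectProperty.hom_ext
  apply GrpCat.hom_ext
  apply Monoid.Coprod.hom_ext
  · refine FreeGroup.ext_hom _ _ fun i => ?_
    rw [Subsingleton.elim i 0]
    exact h
  · exact congr_arg (fun φ => φ.hom.hom) h'

theorem eq_cons {A G : Gr} (f : freeProd (free 1) A ⟶ G) :
    f = cons (f.hom.hom (gen A)) (u A (free 1) ≫ f) :=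
  freeProd_hom_ext (cons_gen _ _).symm (u_comp_cons _ _).symm

theorem cons_comp {A G H : Gr} (g : G.obj) (f : A ⟶ G) (φ : G ⟶ H) :
    cons g f ≫ φ = cons (φ.hom.hom g) (f ≫ φ) := by
  refine freeProd_hom_ext ?_ ?_
  · rw [cons_gen]
    exact congr_arg φ.hom.hom (cons_gen g f)
  · rw [u_comp_cons, ← Category.assoc, u_comp_cons]

theorem freeProdMap_eq_cons {A B : Gr} (φ : A ⟶ B) :
    freeProdMap (free 1) φ = cons (gen B) (φ ≫ u B (free 1)) := by
  refine freeProd_hom_ext ?_ ?_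
  · rw [cons_gen]
    rfl
  · rw [u_comp_cons]
    rfl

theorem freeProdMap_comp_cons {A B G : Gr} (φ : A ⟶ B) (g : G.obj) (f : B ⟶ G) :
    freeProdMap (free 1) φ ≫ cons g f = cons g (φ ≫ f) := by
  rw [freeProdMap_eq_cons, cons_comp, cons_gen, Category.assoc, u_comp_cons]

/-- The product `x y` of the generators of the two factors `ℤ` of `ℤ * (ℤ * A)`. -/
def mulGen (A : Gr) : (freeProd (free 1) (freeProd (free 1) A)).obj :=
  gen (freeProd (free 1) A) * (u (freeProd (free 1) A) (free 1)).hom.hom (gen A)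

/-- The morphism `ℤ * A → ℤ * (ℤ * A)` that sends the generator of `ℤ` to the product of the two
generators. -/
def merge (A : Gr) : freeProd (free 1) A ⟶ freeProd (free 1) (freeProd (free 1) A) :=
  cons (mulGen A) (u A (free 1) ≫ u (freeProd (free 1) A) (free 1))

theorem cons_mulGen {A G : Gr} (g h : G.obj) (f : A ⟶ G) :
    (cons g (cons h f)).hom.hom (mulGen A) = g * h := by
  rw [mulGen, map_mul, cons_gen]
  congr 1
  have := congr_arg (fun φ => φ.hom.hom (gen A)) (u_comp_cons g (cons h f))
  exact this.trans (cons_gen h f)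

theorem merge_comp_cons {A G : Gr} (g h : G.obj) (f : A ⟶ G) :
    merge A ≫ cons g (cons h f) = cons (g * h) f := by
  rw [merge, cons_comp, cons_mulGen, Category.assoc, u_comp_cons, u_comp_cons]

/-- The inverse sends the first generator `x` to `x y⁻¹`. This is the invertibility that condition 3
requires in order to be applied to `merge`. -/
theorem isIso_desc_mulGen (A : Gr) :
    IsIso (desc (point (mulGen A)) (u (freeProd (free 1) A) (free 1))) := by
  let B := freeProd (free 1) A
  let y : (freeProd (free 1) B).obj := (u B (free 1)).hom.hom (gen A)
  have hy : ∀ g : (freeProd (free 1) B).obj,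
      (cons g (u B (free 1))).hom.hom y = y := fun g =>
    congr_arg (fun φ => φ.hom.hom (gen A)) (u_comp_cons g (u B (free 1)))
  change IsIso (cons (gen B * y) (u B (free 1)))
  refine ⟨cons (gen B * y⁻¹) (u B (free 1)), ?_, ?_⟩
  · refine freeProd_hom_ext ?_ ?_
    · rw [cons_comp, cons_gen, map_mul, cons_gen, hy]
      exact inv_mul_cancel_right _ _
    · rw [← Category.assoc, u_comp_cons, u_comp_cons, Category.comp_id]
  · refine freeProd_hom_ext ?_ ?_
    · rw [cons_comp, cons_gen, map_mul, map_inv, cons_gen, hy]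
      exact mul_inv_cancel_right _ _
    · rw [← Category.assoc, u_comp_cons, u_comp_cons, Category.comp_id]

/-- The free product `ℤ * (ℤ * (⋯ * A))` with `n` factors `ℤ`. -/
def iter (A : Gr) : ℕ → Gr
  | 0 => A
  | n + 1 => freeProd (free 1) (iter A n)

/-- The face morphisms: on `gr(-, G)`, whose values on `iter A n` are the tuples
`(g₁, …, gₙ, f)`, they induce the faces of the bar construction. -/
def face (A : Gr) : (n i : ℕ) → (iter A n ⟶ iter A (n + 1))
  | n, 0 => u (iter A n) (free 1)
  | 0, _ + 1 => u A (free 1)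
  | n + 1, 1 => merge (iter A n)
  | n + 1, i + 2 => freeProdMap (free 1) (face A n (i + 1))

end Gr

/-! ### The bar complex of a free group -/

namespace FunctorTensor

variable (k : Type) [CommRing k] {C : Type u} [Category.{0} C]

/-- The morphism `P_B ⟶ P_A` given by precomposition with `φ : A ⟶ B`. -/
def stdProjMap {A B : C} (φ : A ⟶ B) : stdProj k B ⟶ stdProj k A :=
  stdProjDesc (stdProjMk k φ)

theorem stdProjMap_app {A B : C} (φ : A ⟶ B) {G : C} (f : B ⟶ G) :
    (stdProjMap k φ).app G (stdProjMk k f) = stdProjMk k (φ ≫ f) := by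
  rw [stdProjMap, stdProjDesc_app, stdProj_map_mk]

theorem stdProj_linearMap_ext {k : Type} [CommRing k] {c A : C} {N : Type*} [AddCommGroup N]
    [Module k N] {f f' : (stdProj k c).obj A →ₗ[k] N}
    (h : ∀ a, f (stdProjMk k a) = f' (stdProjMk k a)) : f = f' :=
  Finsupp.lhom_ext' (M := k) (φ := f) (ψ := f') fun a => LinearMap.ext_ring (h a)

end FunctorTensor

namespace Gr

open FunctorTensor

variable (k : Type) [CommRing k] (A : Gr) {G : Gr}

/-- The morphism `ℤ * (⋯ * A) → G` given by an element of `G` and a tuple. -/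
def tupleCons {A : Gr} {n : ℕ} (g : G.obj) (f : iter A n ⟶ G) : iter A (n + 1) ⟶ G := cons g f

theorem face_zero_comp_tupleCons {n : ℕ} (g : G.obj) (f : iter A n ⟶ G) :
    face A n 0 ≫ tupleCons g f = f := by
  cases n <;> exact u_comp_cons g f

theorem face_base_comp_tupleCons (i : ℕ) (g : G.obj) (f : iter A 0 ⟶ G) :
    face A 0 (i + 1) ≫ tupleCons g f = f :=
  u_comp_cons g f

theorem face_one_comp_tupleCons {n : ℕ} (g h : G.obj) (f : iter A n ⟶ G) :
    face A (n + 1) 1 ≫ tupleCons g (tupleCons h f) = tupleCons (g * h) f :=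
  merge_comp_cons g h f

theorem face_succ_comp_tupleCons {n : ℕ} (i : ℕ) (g : G.obj) (f : iter A (n + 1) ⟶ G) :
    face A (n + 1) (i + 2) ≫ tupleCons g f = tupleCons g (face A n (i + 1) ≫ f) :=
  freeProdMap_comp_cons _ g f

theorem exists_eq_tupleCons {n : ℕ} (f : iter A (n + 1) ⟶ G) :
    ∃ (g : G.obj) (f' : iter A n ⟶ G), f = tupleCons g f' :=
  ⟨_, _, eq_cons f⟩

/-- The module of bar chains: the free module on the tuples `iter A n ⟶ G`. -/
abbrev barChains (n : ℕ) (G : Gr) : ModuleCat.{0} k := (stdProj k (iter A n)).obj G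

/-- The basis element of the bar chains given by a tuple. -/
def tuple {A : Gr} {n : ℕ} (f : iter A n ⟶ G) : barChains k A n G := stdProjMk k f

variable {k A}

theorem barChains_ext {n : ℕ} {N : Type} [AddCommGroup N] [Module k N]
    {f f' : barChains k A n G →ₗ[k] N} (h : ∀ a, f (tuple k a) = f' (tuple k a)) : f = f' :=
  stdProj_linearMap_ext h

/-- The linear map on bar chains that prepends `g` to tuples. -/
def prepend {n : ℕ} (g : G.obj) : barChains k A n G →ₗ[k] barChains k A (n + 1) G :=
  (stdProjLift fun f => tuple k (tupleCons g f)).hom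

theorem prepend_tuple {n : ℕ} (g : G.obj) (f : iter A n ⟶ G) :
    prepend g (tuple k f) = tuple k (tupleCons g f) :=
  stdProjLift_mk _ f

/-- The linear map on bar chains given by a family of linear maps indexed by the first entry. -/
def ofPrepend {n : ℕ} {N : Type} [AddCommGroup N] [Module k N]
    (F : G.obj → barChains k A n G →ₗ[k] N) : barChains k A (n + 1) G →ₗ[k] N :=
  (stdProjLift (M := ModuleCat.of k N) fun f : iter A (n + 1) ⟶ G =>
    F (f.hom.hom (gen (iter A n))) (tuple k (face A n 0 ≫ f))).hom

theorem ofPrepend_prepend {n : ℕ} {N : Type} [AddCommGroup N] [Module k N]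
    (F : G.obj → barChains k A n G →ₗ[k] N) (g : G.obj) (z : barChains k A n G) :
    ofPrepend F (prepend g z) = F g z := by
  suffices ofPrepend F ∘ₗ prepend g = F g from LinearMap.congr_fun this z
  refine barChains_ext fun f => ?_
  rw [LinearMap.comp_apply, prepend_tuple]
  refine (stdProjLift_mk (M := ModuleCat.of k N) _ _).trans ?_
  rw [face_zero_comp_tupleCons]
  exact congr_arg (fun x => F x (tuple k f)) (cons_gen g f)

theorem barChains_succ_ext {n : ℕ} {N : Type} [AddCommGroup N] [Module k N]
    {f f' : barChains k A (n + 1) G →ₗ[k] N} (h : ∀ g z, f (prepend g z) = f' (prepend g z)) :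
    f = f' := by
  refine barChains_ext fun a => ?_
  obtain ⟨g, b, rfl⟩ := exists_eq_tupleCons A a
  rw [← prepend_tuple, h]

variable (k A)

/-- The alternating sum of all the faces of positive index. -/
def positiveFaces (n : ℕ) : stdProj k (iter A (n + 1)) ⟶ stdProj k (iter A n) :=
  ∑ i ∈ Finset.range (n + 1), (-1 : ℤ) ^ i • stdProjMap k (face A n (i + 1))

/-- The differential of the bar complex, as a morphism of functors. -/
def barD (n : ℕ) : stdProj k (iter A (n + 1)) ⟶ stdProj k (iter A n) :=
  stdProjMap k (face A n 0) - positiveFaces k A n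

variable {k A}

theorem stdProjMap_face_tuple {n : ℕ} (i : ℕ) (f : iter A (n + 1) ⟶ G) :
    (stdProjMap k (face A n i)).app G (tuple k f) = tuple k (face A n i ≫ f) :=
  stdProjMap_app k _ f

theorem positiveFaces_tuple {n : ℕ} (f : iter A (n + 1) ⟶ G) :
    (positiveFaces k A n).app G (tuple k f) =
      ∑ i ∈ Finset.range (n + 1), (-1 : ℤ) ^ i • tuple k (face A n (i + 1) ≫ f) := by
  rw [positiveFaces, NatTrans.app_sum]
  refine (LinearMap.congr_fun (ModuleCat.hom_sum _ _) _).trans ?_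
  rw [LinearMap.sum_apply]
  refine Finset.sum_congr rfl fun i _ => ?_
  rw [← stdProjMap_face_tuple, NatTrans.app_zsmul]
  rfl

/-- The operator `z ↦ z - d (g, z)` on bar chains. -/
def barAct (n : ℕ) (g : G.obj) : barChains k A n G →ₗ[k] barChains k A n G :=
  ((positiveFaces k A n).app G).hom ∘ₗ prepend g

theorem barAct_tuple {n : ℕ} (g : G.obj) (f : iter A n ⟶ G) :
    barAct n g (tuple k f) =
      ∑ i ∈ Finset.range (n + 1), (-1 : ℤ) ^ i • tuple k (face A n (i + 1) ≫ tupleCons g f) := by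
  rw [barAct, LinearMap.comp_apply, prepend_tuple, positiveFaces_tuple]

theorem barAct_zero (g : G.obj) (z : barChains k A 0 G) : barAct 0 g z = z := by
  suffices barAct (k := k) (A := A) 0 g = LinearMap.id from LinearMap.congr_fun this z
  refine barChains_ext fun f => ?_
  rw [barAct_tuple]
  refine (Finset.sum_range_one _).trans ?_
  rw [face_base_comp_tupleCons, pow_zero, one_smul, LinearMap.id_apply]

/-- The face of index one multiplies `g` into `h`. The later faces act on the tail with index
lowered by one, whence the sign. This recursion replaces the simplicial identities. -/
theorem barAct_succ_prepend {n : ℕ} (g h : G.obj) (z : barChains k A n G) :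
    barAct (n + 1) g (prepend h z) = prepend (g * h) z - prepend g (barAct n h z) := by
  suffices barAct (n + 1) g ∘ₗ prepend h = prepend (g * h) - prepend g ∘ₗ barAct n h from
    LinearMap.congr_fun this z
  refine barChains_ext fun f => ?_
  rw [LinearMap.comp_apply, LinearMap.sub_apply, LinearMap.comp_apply, prepend_tuple, prepend_tuple,
    barAct_tuple, barAct_tuple, Finset.sum_range_succ', face_one_comp_tupleCons, map_sum,
    pow_zero, one_smul, sub_eq_add_neg, ← Finset.sum_neg_distrib]
  refine (add_comm _ _).trans ?_
  congr 1
  refine Finset.sum_congr rfl fun i _ => ?_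
  rw [face_succ_comp_tupleCons, map_zsmul, prepend_tuple, pow_succ, mul_neg_one, neg_smul]

/-- On a tuple `(x, y)`, expanding by `barAct_succ_prepend` leaves two terms starting with `g` that
cancel by the induction hypothesis. -/
theorem barAct_mul (n : ℕ) (g h : G.obj) (z : barChains k A n G) :
    barAct n g (barAct n h z) = barAct n (g * h) z := by
  induction n generalizing g h with
  | zero => simp only [barAct_zero]
  | succ n ih =>
    suffices barAct (n + 1) g ∘ₗ barAct (n + 1) h = barAct (n + 1) (g * h) from
      LinearMap.congr_fun this z
    refine barChains_succ_ext fun x y => ?_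
    rw [LinearMap.comp_apply, barAct_succ_prepend, map_sub, barAct_succ_prepend,
      barAct_succ_prepend, barAct_succ_prepend, ih, mul_assoc]
    abel

theorem barD_prepend {n : ℕ} (g : G.obj) (z : barChains k A n G) :
    (barD k A n).app G (prepend g z) = z - barAct n g z := by
  suffices ((barD k A n).app G).hom ∘ₗ prepend g = LinearMap.id - barAct n g from
    LinearMap.congr_fun this z
  refine barChains_ext fun f => ?_
  rw [LinearMap.comp_apply, barD, NatTrans.app_sub, ModuleCat.hom_sub, LinearMap.sub_apply,
    LinearMap.sub_apply, prepend_tuple, stdProjMap_face_tuple, face_zero_comp_tupleCons,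
    barAct, LinearMap.comp_apply, prepend_tuple, LinearMap.id_apply]

/-- Since `d (g, y) = y - g · y`, the claim is that `d` is invariant under `barAct`, which follows
from `barAct_mul`. -/
theorem barD_barD {n : ℕ} (z : barChains k A (n + 2) G) :
    (barD k A n).app G ((barD k A (n + 1)).app G z) = 0 := by
  suffices ((barD k A n).app G).hom ∘ₗ ((barD k A (n + 1)).app G).hom = 0 from
    LinearMap.congr_fun this z
  refine barChains_succ_ext fun g y => ?_
  rw [LinearMap.comp_apply, barD_prepend, map_sub, LinearMap.zero_apply]
  suffices ((barD k A n).app G).hom = ((barD k A n).app G).hom ∘ₗ barAct (n + 1) g from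
    sub_eq_zero.2 (LinearMap.congr_fun this y)
  refine barChains_succ_ext fun h y => ?_
  rw [LinearMap.comp_apply, barAct_succ_prepend, map_sub, barD_prepend, barD_prepend, barD_prepend,
    barAct_mul]
  abel

/-! ### The contraction of the bar complex -/

variable (k A) in
/-- The linear map `k[G] → Hom(C₀, C₁)` that prepends elements of `G`. -/
def prependOne : (G.obj →₀ k) →ₗ[k] barChains k A 0 G →ₗ[k] barChains k A 1 G :=
  Finsupp.linearCombination k fun g => prepend g

variable (k A) in
/-- The linear map `k[G × G] → Hom(C₀, C₂)` that prepends pairs. -/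
def prependTwo : (G.obj × G.obj →₀ k) →ₗ[k] barChains k A 0 G →ₗ[k] barChains k A 2 G :=
  Finsupp.linearCombination k fun p => prepend p.1 ∘ₗ prepend p.2

theorem prependOne_single (g : G.obj) (y : barChains k A 0 G) :
    prependOne k A (Finsupp.single g 1) y = prepend g y := by
  rw [prependOne, Finsupp.linearCombination_single, one_smul]

theorem prependTwo_single (p : G.obj × G.obj) (y : barChains k A 0 G) :
    prependTwo k A (Finsupp.single p 1) y = prepend p.1 (prepend p.2 y) := by
  rw [prependTwo, Finsupp.linearCombination_single, one_smul, LinearMap.comp_apply]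

/-- The boundary `(w, x) ↦ w x - w`. -/
def pairBoundary (k : Type) [CommRing k] (H : Type) [Group H] : (H × H →₀ k) →ₗ[k] (H →₀ k) :=
  Finsupp.lmapDomain k k (fun p : H × H => p.1 * p.2) - Finsupp.lmapDomain k k Prod.fst

theorem pairBoundary_single {H : Type} [Group H] (p : H × H) :
    pairBoundary k H (Finsupp.single p 1) =
      Finsupp.single (p.1 * p.2) 1 - Finsupp.single p.1 1 := by
  rw [pairBoundary, LinearMap.sub_apply, Finsupp.lmapDomain_single_apply,
    Finsupp.lmapDomain_single_apply]

theorem barAct_one_prepend (w x : G.obj) (y : barChains k A 0 G) :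
    barAct 1 w (prepend x y) = prepend (w * x) y - prepend w y := by
  rw [barAct_succ_prepend, barAct_zero]

theorem barAct_prependTwo (a : G.obj) (ζ : G.obj × G.obj →₀ k) (y : barChains k A 0 G) :
    barAct 2 a (prependTwo k A ζ y) =
      prependTwo k A (Finsupp.lmapDomain k k (Prod.map (a * ·) id) ζ) y -
        prepend a (prependOne k A (pairBoundary k G.obj ζ) y) := by
  suffices barAct 2 a ∘ₗ (prependTwo k A).flip y =
      (prependTwo k A).flip y ∘ₗ Finsupp.lmapDomain k k (Prod.map (a * ·) id) -
        prepend a ∘ₗ (prependOne k A).flip y ∘ₗ pairBoundary k G.obj from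
    LinearMap.congr_fun this ζ
  refine Finsupp.lhom_ext' fun p => LinearMap.ext_ring ?_
  simp only [LinearMap.comp_apply, LinearMap.sub_apply, LinearMap.flip_apply,
    Finsupp.lsingle_apply, prependTwo_single, Finsupp.lmapDomain_single_apply,
    pairBoundary_single, map_sub, prependOne_single, barAct_succ_prepend a, barAct_one_prepend,
    Prod.map_fst, Prod.map_snd, id]

theorem barD_prependTwo (ζ : G.obj × G.obj →₀ k) (y : barChains k A 0 G) :
    (barD k A 1).app G (prependTwo k A ζ y) =
      prependOne k A (Finsupp.lmapDomain k k Prod.snd ζ) y -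
        prependOne k A (pairBoundary k G.obj ζ) y := by
  suffices ((barD k A 1).app G).hom ∘ₗ (prependTwo k A).flip y =
      (prependOne k A).flip y ∘ₗ Finsupp.lmapDomain k k Prod.snd -
        (prependOne k A).flip y ∘ₗ pairBoundary k G.obj from
    LinearMap.congr_fun this ζ
  refine Finsupp.lhom_ext' fun p => LinearMap.ext_ring ?_
  simp only [LinearMap.comp_apply, LinearMap.sub_apply, LinearMap.flip_apply,
    Finsupp.lsingle_apply, prependTwo_single, Finsupp.lmapDomain_single_apply,
    pairBoundary_single, map_sub, prependOne_single, barD_prepend, barAct_one_prepend]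

/-- The contracting homotopy of the bar complex built from a map `D : G → k[G × G]`. -/
def barHomotopy (D : G.obj → (G.obj × G.obj →₀ k)) :
    (n : ℕ) → (barChains k A (n + 1) G →ₗ[k] barChains k A (n + 2) G)
  | 0 => ofPrepend fun a => prependTwo k A (D a) - prepend a ∘ₗ prepend 1
  | n + 1 => ofPrepend fun a => prepend a ∘ₗ barHomotopy D n

variable {D : G.obj → (G.obj × G.obj →₀ k)}

theorem barHomotopy_zero_prepend (a : G.obj) (y : barChains k A 0 G) :
    barHomotopy D 0 (prepend a y) = prependTwo k A (D a) y - prepend a (prepend 1 y) := by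
  rw [barHomotopy, ofPrepend_prepend, LinearMap.sub_apply, LinearMap.comp_apply]

theorem barHomotopy_succ_prepend {n : ℕ} (a : G.obj) (y : barChains k A (n + 1) G) :
    barHomotopy D (n + 1) (prepend a y) = prepend a (barHomotopy D n y) := by
  rw [barHomotopy, ofPrepend_prepend, LinearMap.comp_apply]

/-- This is the contraction identity in terms of the action, a form suited to induction. In the base
case, on `(b, y)`, the crossed rule for `D (a * b)` cancels all Fox terms, and the boundary `b - 1`
of `D b` leaves `-(a, b, y)`. -/
theorem barAct_barHomotopy
    (hD : ∀ g h, D (g * h) = D g + Finsupp.lmapDomain k k (Prod.map (g * ·) id) (D h))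
    (hD' : ∀ g, pairBoundary k G.obj (D g) = Finsupp.single g 1 - Finsupp.single 1 1)
    (n : ℕ) (a : G.obj) (z : barChains k A (n + 1) G) :
    barAct (n + 2) a (barHomotopy D n z) - barHomotopy D n (barAct (n + 1) a z) =
      (-1 : ℤ) ^ (n + 1) • prepend a z := by
  induction n generalizing a with
  | zero =>
    suffices barAct 2 a ∘ₗ barHomotopy D 0 - barHomotopy D 0 ∘ₗ barAct 1 a =
      (-1 : ℤ) ^ (0 + 1) • prepend (k := k) (A := A) a from LinearMap.congr_fun this z
    refine barChains_succ_ext fun b y => ?_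
    rw [LinearMap.sub_apply, LinearMap.comp_apply, LinearMap.comp_apply, LinearMap.smul_apply,
      barAct_one_prepend, map_sub (barHomotopy D 0), barHomotopy_zero_prepend,
      barHomotopy_zero_prepend, barHomotopy_zero_prepend, map_sub, barAct_prependTwo, hD', hD,
      map_sub, LinearMap.sub_apply, prependOne_single, prependOne_single, map_add,
      LinearMap.add_apply, barAct_succ_prepend a, barAct_one_prepend, mul_one, sub_self, map_zero,
      map_sub]
    simp only [zero_add, pow_one, neg_smul, one_smul]
    abel
  | succ n ih =>
    suffices barAct (n + 3) a ∘ₗ barHomotopy D (n + 1) - barHomotopy D (n + 1) ∘ₗ barAct (n + 2) a =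
      (-1 : ℤ) ^ (n + 2) • prepend (k := k) (A := A) a from LinearMap.congr_fun this z
    refine barChains_succ_ext fun b y => ?_
    have := congr_arg (prepend a) (ih b y)
    rw [map_sub, map_zsmul] at this
    rw [LinearMap.sub_apply, LinearMap.comp_apply, LinearMap.comp_apply, LinearMap.smul_apply,
      barHomotopy_succ_prepend, barAct_succ_prepend, barAct_succ_prepend, map_sub,
      barHomotopy_succ_prepend, barHomotopy_succ_prepend, pow_succ, mul_neg_one, neg_smul, ← this]
    abel

theorem barD_barHomotopy
    (hD : ∀ g h, D (g * h) = D g + Finsupp.lmapDomain k k (Prod.map (g * ·) id) (D h))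
    (hD' : ∀ g, pairBoundary k G.obj (D g) = Finsupp.single g 1 - Finsupp.single 1 1)
    (n : ℕ) (z : barChains k A (n + 2) G) :
    (barD k A (n + 2)).app G (barHomotopy D (n + 1) z) -
      barHomotopy D n ((barD k A (n + 1)).app G z) = (-1 : ℤ) ^ n • z := by
  suffices ((barD k A (n + 2)).app G).hom ∘ₗ barHomotopy D (n + 1) -
      barHomotopy D n ∘ₗ ((barD k A (n + 1)).app G).hom = (-1 : ℤ) ^ n • LinearMap.id from
    LinearMap.congr_fun this z
  refine barChains_succ_ext fun a y => ?_
  have := barAct_barHomotopy hD hD' n a y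
  rw [pow_succ, mul_neg_one, neg_smul] at this
  rw [LinearMap.sub_apply, LinearMap.comp_apply, LinearMap.comp_apply, LinearMap.smul_apply,
    barHomotopy_succ_prepend, barD_prepend, barD_prepend, map_sub, LinearMap.id_apply,
    ← neg_eq_iff_eq_neg.2 this]
  abel

/-- The term `(a, 1, y)` subtracted in `barHomotopy` has boundary `(1, y)`, which cancels the
contribution of `1` in the boundary `a - 1` of `D a`. -/
theorem barD_barHomotopy_zero
    (hD' : ∀ g, pairBoundary k G.obj (D g) = Finsupp.single g 1 - Finsupp.single 1 1)
    (a : G.obj) (y : barChains k A 0 G) :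
    (barD k A 1).app G (barHomotopy D 0 (prepend a y)) =
      prependOne k A (Finsupp.lmapDomain k k Prod.snd (D a)) y - prepend a y := by
  rw [barHomotopy_zero_prepend, map_sub, barD_prependTwo, hD', barD_prepend, barAct_one_prepend,
    map_sub, LinearMap.sub_apply, prependOne_single, prependOne_single, mul_one]
  abel

variable (k) in
theorem exists_foxDerivative (G : Gr) :
    ∃ D : G.obj → (G.obj × G.obj →₀ k),
      (∀ g h, D (g * h) = D g + Finsupp.lmapDomain k k (Prod.map (g * ·) id) (D h)) ∧
      ∀ g, pairBoundary k G.obj (D g) = Finsupp.single g 1 - Finsupp.single 1 1 := by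
  obtain ⟨_, ⟨b⟩⟩ := G.property
  exact b.exists_foxDerivative k

theorem exists_barD_eq {n : ℕ} (z : barChains k A (n + 2) G)
    (hz : (barD k A (n + 1)).app G z = 0) :
    ∃ w : barChains k A (n + 3) G, (barD k A (n + 2)).app G w = z := by
  obtain ⟨D, hD, hD'⟩ := exists_foxDerivative k G
  refine ⟨(-1 : ℤ) ^ n • barHomotopy D (n + 1) z, ?_⟩
  have h := barD_barHomotopy hD hD' n z
  rw [hz, map_zero, sub_zero] at h
  rw [map_zsmul, h, smul_smul, ← mul_pow, neg_one_mul, neg_neg, one_pow, one_smul]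

end Gr

/-! ### The projective resolution of `𝔞 ⊗ P_r` -/

/-- Evaluation at an object commutes with homology, so contractions that are not natural in the
object suffice. -/
theorem shortComplex_exact_of_app {k : Type} [CommRing k] {C : Type u} [Category.{v} C]
    (S : ShortComplex (C ⥤ ModuleCat.{0} k))
    (h : ∀ (c : C) (x : S.X₂.obj c), S.g.app c x = 0 → ∃ y, S.f.app c y = x) : S.Exact := by
  rw [ShortComplex.exact_iff_isZero_homology]
  refine Functor.isZero _ fun c => ?_
  have h' : (S.map ((evaluation C (ModuleCat.{0} k)).obj c)).Exact :=
    (ShortComplex.moduleCat_exact_iff _).2 (h c)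
  exact ((ShortComplex.exact_iff_isZero_homology _).1 h').of_iso
    (S.mapHomologyIso ((evaluation C (ModuleCat.{0} k)).obj c)).symm

namespace Gr

open FunctorTensor

variable (k : Type) [CommRing k] (A : Gr) {G : Gr}

/-- The class in `k ⊗ G_ab` of an element of `G`. -/
def abClass (g : G.obj) : (ab k).obj G :=
  ((1 : k) ⊗ₜ[ℤ] Additive.ofMul (Abelianization.of g) : k ⊗[ℤ] Additive (Abelianization G.obj))

theorem abClass_mul (g h : G.obj) : abClass k (g * h) = abClass k g + abClass k h := by
  rw [abClass, map_mul, ofMul_mul]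
  exact TensorProduct.tmul_add _ _ _

/-- The pure tensor of `x` and `y` in the value at `G` of the pointwise tensor product. -/
def pureTensor {F F' : Gr ⥤ ModuleCat.{0} k} (x : F.obj G) (y : F'.obj G) : (F ⊗ F').obj G :=
  (x ⊗ₜ[k] y : F.obj G ⊗[k] F'.obj G)

theorem pureTensor_add_left {F F' : Gr ⥤ ModuleCat.{0} k} (x x' : F.obj G) (y : F'.obj G) :
    pureTensor k (x + x') y = pureTensor k x y + pureTensor k x' y :=
  TensorProduct.add_tmul _ _ _

/-- The augmentation `P_{n + 1} ⟶ 𝔞 ⊗ P_n` of the bar complex. -/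
def barAug : stdProj k (iter A 1) ⟶ ab k ⊗ stdProj k (iter A 0) :=
  stdProjDesc (pureTensor k (abClass k (gen (iter A 0))) (stdProjMk k (face A 0 0)))

variable {k A}

theorem barAug_prepend (g : G.obj) (y : barChains k A 0 G) :
    (barAug k A).app G (prepend g y) = pureTensor k (abClass k g) y := by
  let t : barChains k A 0 G →ₗ[k] (ab k ⊗ stdProj k (iter A 0)).obj G :=
    TensorProduct.mk k ((ab k).obj G) ((stdProj k (iter A 0)).obj G) (abClass k g)
  suffices ((barAug k A).app G).hom ∘ₗ prepend g = t from LinearMap.congr_fun this y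
  refine barChains_ext fun f => ?_
  rw [LinearMap.comp_apply, prepend_tuple]
  refine (stdProjDesc_app _ _).trans ?_
  change pureTensor k (abClass k ((cons g f).hom.hom (gen (iter A 0))))
    ((stdProj k (iter A 0)).map (tupleCons g f) (stdProjMk k (face A 0 0))) = _
  have h := stdProj_map_mk (k := k) (face A 0 0) (tupleCons g f)
  rw [face_zero_comp_tupleCons] at h
  refine (congr_arg _ h).trans ?_
  exact congr_arg (fun x => pureTensor k (abClass k x) (tuple k f)) (cons_gen g f)

/-- The boundary of `(g, h, y)` is `(h, y) - (g h, y) + (g, y)`, so this is additivity of the class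
in `G_ab`. -/
theorem barAug_barD (z : barChains k A 2 G) :
    (barAug k A).app G ((barD k A 1).app G z) = 0 := by
  suffices ((barAug k A).app G).hom ∘ₗ ((barD k A 1).app G).hom = 0 from
    LinearMap.congr_fun this z
  refine barChains_succ_ext fun g y => ?_
  rw [LinearMap.comp_apply, barD_prepend, LinearMap.zero_apply]
  suffices ((barAug k A).app G).hom = ((barAug k A).app G).hom ∘ₗ barAct 1 g from
    (map_sub _ _ _).trans (sub_eq_zero.2 (LinearMap.congr_fun this y))
  refine barChains_succ_ext fun h y => ?_
  rw [LinearMap.comp_apply, barAct_one_prepend, map_sub, barAug_prepend, barAug_prepend,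
    barAug_prepend, abClass_mul, pureTensor_add_left, add_sub_cancel_left]

theorem barAug_surjective : Function.Surjective ((barAug k A).app G) := by
  intro z
  induction z using TensorProduct.induction_on with
  | zero => exact ⟨0, map_zero _⟩
  | add x y hx hy =>
    obtain ⟨x', rfl⟩ := hx
    obtain ⟨y', rfl⟩ := hy
    exact ⟨x' + y', map_add _ _ _⟩
  | tmul x y =>
    induction x using TensorProduct.induction_on with
    | zero => exact ⟨0, (map_zero _).trans (TensorProduct.zero_tmul _ _).symm⟩
    | add x x' hx hx' =>
      obtain ⟨w, hw⟩ := hx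
      obtain ⟨w', hw'⟩ := hx'
      refine ⟨w + w', (map_add _ _ _).trans ?_⟩
      rw [hw, hw']
      exact (TensorProduct.add_tmul _ _ _).symm
    | tmul c m =>
      obtain ⟨g, hg⟩ := QuotientGroup.mk_surjective m.toMul
      refine ⟨c • prepend g y, ?_⟩
      rw [map_smul, barAug_prepend]
      refine (TensorProduct.smul_tmul' c _ _).trans ?_
      congr 1
      refine (TensorProduct.smul_tmul' c (1 : k) _).trans ?_
      rw [smul_eq_mul, mul_one]
      exact congr_arg (fun x => c ⊗ₜ[ℤ] Additive.ofMul x) hg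

/-- The second projection forgets the translated coordinate, so it turns `D` into a true
homomorphism `L` to an abelian group, which factors through `𝔞(G)`. Thus `d s` is `-id` plus a map
factoring through the augmentation, and `-s z` bounds `z`. -/
theorem exists_barD_one_eq (z : barChains k A 1 G) (hz : (barAug k A).app G z = 0) :
    ∃ w : barChains k A 2 G, (barD k A 1).app G w = z := by
  obtain ⟨D, hD, hD'⟩ := exists_foxDerivative k G
  let L : G.obj →* Multiplicative (G.obj →₀ k) :=
    MonoidHom.mk' (fun g => Multiplicative.ofAdd (Finsupp.lmapDomain k k Prod.snd (D g))) <| by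
      intro g h
      rw [hD, map_add, ofAdd_add]
      congr 2
      rw [← LinearMap.comp_apply, ← Finsupp.lmapDomain_comp]
      rfl
  let L' : (ab k).obj G →ₗ[k] (G.obj →₀ k) :=
    LinearMap.liftBaseChange k (AddMonoidHom.toIntLinearMap
      (MonoidHom.toAdditiveLeft (Abelianization.lift L)))
  let Λ : (ab k ⊗ stdProj k (iter A 0)).obj G →ₗ[k] barChains k A 1 G :=
    TensorProduct.lift (prependOne k A ∘ₗ L')
  have hL' : ∀ g, L' (abClass k g) = Finsupp.lmapDomain k k Prod.snd (D g) := by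
    intro g
    refine (LinearMap.liftBaseChange_one_tmul k _ _).trans ?_
    rfl
  have key : ((barD k A 1).app G).hom ∘ₗ barHomotopy D 0 =
      Λ ∘ₗ ((barAug k A).app G).hom - LinearMap.id := by
    refine barChains_succ_ext fun a y => ?_
    rw [LinearMap.comp_apply, barD_barHomotopy_zero hD', LinearMap.sub_apply, LinearMap.comp_apply,
      barAug_prepend, LinearMap.id_apply, ← hL']
    rfl
  refine ⟨-barHomotopy D 0 z, ?_⟩
  have := LinearMap.congr_fun key z
  rw [LinearMap.comp_apply, LinearMap.sub_apply, LinearMap.comp_apply, hz, map_zero, zero_sub,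
    LinearMap.id_apply] at this
  rw [map_neg, this, neg_neg]

theorem barD_comp_barD (n : ℕ) : barD k A (n + 1) ≫ barD k A n = 0 := by
  ext G : 2
  exact ModuleCat.hom_ext (LinearMap.ext barD_barD)

theorem barD_comp_barAug : barD k A 1 ≫ barAug k A = 0 := by
  ext G : 2
  exact ModuleCat.hom_ext (LinearMap.ext barAug_barD)

variable (k A)

/-- The bar complex without its term of degree zero. -/
def barComplex : ChainComplex (Gr ⥤ ModuleCat.{0} k) ℕ :=
  ChainComplex.of (fun n => stdProj k (iter A (n + 1))) (fun n => barD k A (n + 1))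
    fun n => barD_comp_barD (n + 1)

theorem barComplex_d (n : ℕ) : (barComplex k A).d (n + 1) n = barD k A (n + 1) :=
  ChainComplex.of_d (fun n => stdProj k (iter A (n + 1))) (fun n => barD k A (n + 1)) n

theorem barComplex_exactAt_succ (n : ℕ) : (barComplex k A).ExactAt (n + 1) := by
  rw [HomologicalComplex.exactAt_iff' _ (n + 2) (n + 1) n (by simp) (by simp)]
  refine shortComplex_exact_of_app _ fun G z hz => ?_
  change ((barComplex k A).d (n + 1) n).app G z = 0 at hz
  change ∃ y, ((barComplex k A).d (n + 2) (n + 1)).app G y = z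
  rw [barComplex_d] at hz ⊢
  exact exists_barD_eq z hz

/-- The projective resolution of `𝔞 ⊗ P_A` given by the bar complex. -/
def barResolution : ProjectiveResolution (ab k ⊗ stdProj k (iter A 0)) where
  complex := barComplex k A
  projective n := inferInstanceAs (Projective (stdProj k (iter A (n + 1))))
  π := (ChainComplex.toSingle₀Equiv _ _).symm ⟨barAug k A, by
    rw [barComplex_d]
    exact barD_comp_barAug⟩
  quasiIso := ⟨fun n => by
    cases n with
    | zero =>
      -- In degree zero the condition says that the augmentation is surjective with kernel the image
      -- of the last differential.
      rw [ChainComplex.quasiIsoAt₀_iff, ShortComplex.quasiIso_iff_of_zeros' _ rfl rfl rfl]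
      refine ⟨shortComplex_exact_of_app _ fun G z hz => ?_, (NatTrans.epi_iff_epi_app _).2 fun G =>
        (ModuleCat.epi_iff_surjective _).2 barAug_surjective⟩
      change ∃ y, ((barComplex k A).d 1 0).app G y = z
      rw [barComplex_d]
      exact exists_barD_one_eq z hz
    | succ n =>
      rw [quasiIsoAt_iff_exactAt' (hL := ChainComplex.exactAt_succ_single_obj ..)]
      exact barComplex_exactAt_succ k A n⟩

end Gr

/-! ### The Yoneda isomorphism `X ⊗ P_c ≅ X(c)` -/

namespace FunctorTensor

variable {k : Type} [CommRing k] {C : Type u} [Category.{0} C] (X : Cᵒᵖ ⥤ ModuleCat.{0} k)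

open Classical in
/-- The map `X(c) → X ⊗ P_c` that sends `x` to the class of `x ⊗ id`. -/
def toTensorStdProj (c : C) : X.obj (op c) →ₗ[k] tensorModule X (stdProj k c) :=
  (relations X (stdProj k c)).mkQ ∘ₗ
    DirectSum.lof k C (fun A => X.obj (op A) ⊗[k] (stdProj k c).obj A) c ∘ₗ
      (TensorProduct.mk k (X.obj (op c)) ((stdProj k c).obj c)).flip (stdProjMk k (𝟙 c))

/-- The map `P_c(A) → Hom(X(A), X(c))` given by the functoriality of `X`. -/
def stdProjAction (c A : C) : (stdProj k c).obj A →ₗ[k] X.obj (op A) →ₗ[k] X.obj (op c) :=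
  (stdProjLift (M := ModuleCat.of k (X.obj (op A) →ₗ[k] X.obj (op c)))
    fun f => (X.map f.op).hom).hom

theorem stdProjAction_mk {c A : C} (f : c ⟶ A) (x : X.obj (op A)) :
    stdProjAction X c A (stdProjMk k f) x = X.map f.op x :=
  LinearMap.congr_fun (stdProjLift_mk (M := ModuleCat.of k (X.obj (op A) →ₗ[k] X.obj (op c)))
    (fun f => (X.map f.op).hom) f) x

open Classical in
/-- The map `⨁ A, X(A) ⊗ P_c(A) → X(c)` that sends `x ⊗ f` to `X(f)(x)`. -/
def sumStdProjEval (c : C) : (⨁ A : C, X.obj (op A) ⊗[k] (stdProj k c).obj A) →ₗ[k] X.obj (op c) :=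
  DirectSum.toModule k C _ fun A => TensorProduct.lift (stdProjAction X c A).flip

theorem relations_le_ker_sumStdProjEval (c : C) :
    relations X (stdProj k c) ≤ LinearMap.ker (sumStdProjEval X c) := by
  classical
  refine Submodule.span_le.2 ?_
  rintro _ ⟨A, B, f, x, y, rfl⟩
  refine LinearMap.mem_ker.2 ?_
  rw [map_sub, sub_eq_zero, sumStdProjEval, DirectSum.toModule_lof, DirectSum.toModule_lof,
    TensorProduct.lift.tmul, TensorProduct.lift.tmul, LinearMap.flip_apply, LinearMap.flip_apply]
  suffices (stdProjAction X c A).flip (X.map f.op x) =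
      (stdProjAction X c B).flip x ∘ₗ ((stdProj k c).map f).hom from LinearMap.congr_fun this y
  refine stdProj_linearMap_ext fun a => ?_
  rw [LinearMap.comp_apply, LinearMap.flip_apply, LinearMap.flip_apply, stdProj_map_mk,
    stdProjAction_mk, stdProjAction_mk, op_comp, X.map_comp, ConcreteCategory.comp_apply]

/-- The map `X ⊗ P_c → X(c)` that sends the class of `x ⊗ f` to `X(f)(x)`. -/
def tensorStdProjEval (c : C) : tensorModule X (stdProj k c) →ₗ[k] X.obj (op c) :=
  (relations X (stdProj k c)).liftQ (sumStdProjEval X c) (relations_le_ker_sumStdProjEval X c)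

-- The element `f` of `P_c(A)` is the image of `id` under `f`, so a defining relation moves `f`
-- across the tensor sign.
open Classical in
theorem mkQ_lof_tmul_stdProjMk {c A : C} (f : c ⟶ A) (x : X.obj (op A)) :
    (relations X (stdProj k c)).mkQ
      (DirectSum.lof k C (fun A => X.obj (op A) ⊗[k] (stdProj k c).obj A) A
        (x ⊗ₜ[k] stdProjMk k f)) = toTensorStdProj X c (X.map f.op x) := by
  refine (sub_eq_zero.1 ?_).symm
  refine ((map_sub (relations X (stdProj k c)).mkQ _ _).symm.trans ?_)
  refine (Submodule.Quotient.mk_eq_zero _).2 (Submodule.subset_span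
    ⟨c, A, f, x, stdProjMk k (𝟙 c), ?_⟩)
  rw [stdProj_map_mk, Category.id_comp]
  rfl

theorem tensorStdProjEval_toTensorStdProj (c : C) (x : X.obj (op c)) :
    tensorStdProjEval X c (toTensorStdProj X c x) = x := by
  classical
  refine (Submodule.liftQ_apply _ _ _).trans ?_
  rw [sumStdProjEval, LinearMap.comp_apply, DirectSum.toModule_lof]
  refine (TensorProduct.lift.tmul _ _).trans ?_
  rw [LinearMap.flip_apply, stdProjAction_mk, op_id, X.map_id]
  rfl

theorem toTensorStdProj_injective (c : C) : Function.Injective (toTensorStdProj X c) :=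
  Function.LeftInverse.injective (tensorStdProjEval_toTensorStdProj X c)

theorem toTensorStdProj_surjective (c : C) : Function.Surjective (toTensorStdProj X c) := by
  classical
  suffices toTensorStdProj X c ∘ₗ tensorStdProjEval X c = LinearMap.id from
    fun z => ⟨_, LinearMap.congr_fun this z⟩
  refine Submodule.linearMap_qext _ (DirectSum.linearMap_ext _ fun A => ?_)
  refine TensorProduct.ext (LinearMap.ext fun x => ?_)
  refine stdProj_linearMap_ext fun f => ?_
  refine Eq.trans ?_ (mkQ_lof_tmul_stdProjMk X f x).symm
  refine congr_arg (toTensorStdProj X c) ?_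
  refine (Submodule.liftQ_apply _ _ _).trans ?_
  rw [sumStdProjEval, DirectSum.toModule_lof]
  refine (TensorProduct.lift.tmul _ _).trans ?_
  rw [LinearMap.flip_apply, stdProjAction_mk]

theorem tensorFunctor_map_stdProjMap {A B : C} (φ : A ⟶ B) (x : X.obj (op B)) :
    (tensorFunctor X).map (stdProjMap k φ) (toTensorStdProj X B x) =
      toTensorStdProj X A (X.map φ.op x) := by
  classical
  rw [← mkQ_lof_tmul_stdProjMk]
  refine Eq.trans (b := (relations X (stdProj k A)).mkQ (sumMap X (stdProjMap k φ)
    (DirectSum.lof k C (fun A => X.obj (op A) ⊗[k] (stdProj k B).obj A) B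
      (x ⊗ₜ[k] stdProjMk k (𝟙 B))))) rfl ?_
  refine congr_arg (relations X (stdProj k A)).mkQ ?_
  refine (DirectSum.lmap_lof _ _ _).trans ?_
  congr 1
  refine (LinearMap.lTensor_tmul _ _ _ _).trans ?_
  congr 1
  refine (stdProjMap_app k φ (𝟙 B)).trans ?_
  rw [Category.comp_id]

end FunctorTensor

/-! ### The contraction of the complex of values of `X` -/

namespace Gr

open FunctorTensor

variable {k : Type} [CommRing k] (X : Grᵒᵖ ⥤ ModuleCat.{0} k) (A : Gr)

/-- The map induced on the values of `X` by the bar differential. -/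
def coefD (n : ℕ) : X.obj (op (iter A (n + 1))) ⟶ X.obj (op (iter A n)) :=
  X.map (face A n 0).op -
    ∑ i ∈ Finset.range (n + 1), (-1 : ℤ) ^ i • X.map (face A n (i + 1)).op

theorem tensorFunctor_map_barD (n : ℕ) (x : X.obj (op (iter A (n + 1)))) :
    (tensorFunctor X).map (barD k A n) (toTensorStdProj X _ x) =
      toTensorStdProj X _ (coefD X A n x) := by
  let ι (m : ℕ) : X.obj (op (iter A m)) →ₗ[k] (tensorFunctor X).obj (stdProj k (iter A m)) :=
    toTensorStdProj X (iter A m)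
  suffices ((tensorFunctor X).map (barD k A n)).hom ∘ₗ ι (n + 1) = ι n ∘ₗ (coefD X A n).hom from
    LinearMap.congr_fun this x
  have hf : ∀ i, ((tensorFunctor X).map (stdProjMap k (face A n i))).hom ∘ₗ ι (n + 1) =
      ι n ∘ₗ (X.map (face A n i).op).hom := fun i =>
    LinearMap.ext fun x => tensorFunctor_map_stdProjMap X (face A n i) x
  rw [barD, positiveFaces, coefD, Functor.map_sub, Functor.map_sum, ModuleCat.hom_sub,
    ModuleCat.hom_sub, ModuleCat.hom_sum, ModuleCat.hom_sum, LinearMap.sub_comp,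
    LinearMap.comp_sub, hf]
  congr 1
  ext x
  rw [LinearMap.comp_apply, LinearMap.comp_apply, LinearMap.sum_apply, LinearMap.sum_apply, map_sum]
  refine Finset.sum_congr rfl fun i _ => ?_
  rw [← LinearMap.comp_apply, ← LinearMap.comp_apply]
  refine LinearMap.congr_fun ?_ x
  rw [Functor.map_zsmul, ModuleCat.hom_zsmul, ModuleCat.hom_zsmul, LinearMap.smul_comp, hf,
    LinearMap.comp_smul]

variable {X}
variable (ξ : ∀ A T : Gr, X.obj (op A) ⟶ X.obj (op (freeProd T A)))

/-- The homotopy `ξ(-, ℤ)` on the values of `X`. -/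
def coefHomotopy (n : ℕ) : X.obj (op (iter A n)) ⟶ X.obj (op (iter A (n + 1))) :=
  ξ (iter A n) (free 1)

variable {ξ}

theorem coefHomotopy_face_zero
    (h₂ : ∀ A T : Gr, ξ A T ≫ X.map (u A T).op = 𝟙 (X.obj (op A))) (n : ℕ) :
    coefHomotopy A ξ n ≫ X.map (face A n 0).op = 𝟙 _ := by
  cases n <;> exact h₂ _ _

theorem coefHomotopy_face_succ
    (h₁ : ∀ (A B T : Gr) (φ : A ⟶ B), X.map φ.op ≫ ξ A T = ξ B T ≫ X.map (freeProdMap T φ).op)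
    (h₃ : ∀ (A B T : Gr) (φ : A ⟶ B) (τ : T ⟶ freeProd T B), IsIso (desc τ (u B T)) →
        X.map φ.op ≫ ξ A T = ξ B T ≫ X.map (desc τ (φ ≫ u B T)).op) (n i : ℕ) :
    coefHomotopy A ξ (n + 1) ≫ X.map (face A (n + 1) (i + 1)).op =
      X.map (face A n i).op ≫ coefHomotopy A ξ n := by
  cases i with
  | zero =>
    -- Condition 3 for `φ` the inclusion of `iter A n` in `ℤ * iter A n` and `τ` sending the
    -- generator to `x y`: the resulting `ψ` is `merge`.
    refine Eq.trans ?_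
      (h₃ _ _ _ (face A n 0) (point (mulGen (iter A n))) (isIso_desc_mulGen _)).symm
    cases n <;> rfl
  | succ i => exact (h₁ _ _ _ (face A n (i + 1))).symm

/-- The face of index zero gives the identity; each later face composed with the homotopy is the
homotopy after the face of one lower index, so these reassemble into `coefD X A n`. -/
theorem coefHomotopy_coefD
    (h₁ : ∀ (A B T : Gr) (φ : A ⟶ B), X.map φ.op ≫ ξ A T = ξ B T ≫ X.map (freeProdMap T φ).op)
    (h₂ : ∀ A T : Gr, ξ A T ≫ X.map (u A T).op = 𝟙 (X.obj (op A)))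
    (h₃ : ∀ (A B T : Gr) (φ : A ⟶ B) (τ : T ⟶ freeProd T B), IsIso (desc τ (u B T)) →
        X.map φ.op ≫ ξ A T = ξ B T ≫ X.map (desc τ (φ ≫ u B T)).op) (n : ℕ) :
    coefHomotopy A ξ (n + 1) ≫ coefD X A (n + 1) = 𝟙 _ - coefD X A n ≫ coefHomotopy A ξ n := by
  have h : ∀ i, coefHomotopy A ξ (n + 1) ≫ ((-1 : ℤ) ^ i • X.map (face A (n + 1) (i + 1)).op) =
      (-1 : ℤ) ^ i • X.map (face A n i).op ≫ coefHomotopy A ξ n := fun i => by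
    rw [Preadditive.comp_zsmul, coefHomotopy_face_succ A h₁ h₃]
  rw [coefD, Preadditive.comp_sub, coefHomotopy_face_zero A h₂, Preadditive.comp_sum,
    Finset.sum_congr rfl fun i _ => h i, Finset.sum_range_succ', coefD, Preadditive.sub_comp,
    Preadditive.sum_comp, pow_zero, one_smul, sub_eq_add_neg (_ ≫ _), ← Finset.sum_neg_distrib,
    add_comm (_ ≫ _)]
  congr 2
  refine Finset.sum_congr rfl fun i _ => ?_
  rw [Preadditive.zsmul_comp, pow_succ, mul_neg_one, neg_smul]

/-- Both faces `A → ℤ * A` are the canonical inclusion, as the coefficients are trivial. -/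
theorem coefD_zero : coefD X A 0 = 0 := by
  refine sub_eq_zero.2 (((Finset.sum_range_one _).trans ?_).symm)
  rw [pow_zero, one_smul]
  rfl

end Gr

end

/-! ### Vanishing of Tor -/

theorem mainTheorem7 (k : Type) [CommRing k] (X : Grᵒᵖ ⥤ ModuleCat.{0} k)
    (ξ : ∀ A T : Gr, X.obj (op A) ⟶ X.obj (op (Gr.freeProd T A)))
    (h₁ : ∀ (A B T : Gr) (φ : A ⟶ B),
      X.map φ.op ≫ ξ A T = ξ B T ≫ X.map (Gr.freeProdMap T φ).op)
    (h₂ : ∀ A T : Gr, ξ A T ≫ X.map (Gr.u A T).op = 𝟙 (X.obj (op A)))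
    (h₃ : ∀ (A B T : Gr) (φ : A ⟶ B) (τ : T ⟶ Gr.freeProd T B),
      IsIso (Gr.desc τ (Gr.u B T)) →
        X.map φ.op ≫ ξ A T = ξ B T ≫ X.map (Gr.desc τ (φ ≫ Gr.u B T)).op)
    (r i : ℕ) :
    Limits.IsZero (FunctorTensor.Tor i X (Gr.ab k ⊗ Gr.P k r)) := by
  let A := Gr.free r
  let K := Gr.barComplex k A
  refine Limits.IsZero.of_iso ?_
    ((Gr.barResolution k A).isoLeftDerivedObj (FunctorTensor.tensorFunctor X) i)
  let TK := ((FunctorTensor.tensorFunctor X).mapHomologicalComplex _).obj K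
  change Limits.IsZero (TK.homology i)
  rw [← HomologicalComplex.exactAt_iff_isZero_homology]
  -- Degree `n` of the resolution is bar degree `n + 1`.
  have hTK : ∀ n (x : X.obj (op (Gr.iter A (n + 2)))),
      TK.d (n + 1) n (FunctorTensor.toTensorStdProj X (Gr.iter A (n + 2)) x) =
        FunctorTensor.toTensorStdProj X (Gr.iter A (n + 1)) (Gr.coefD X A (n + 1) x) := by
    intro n x
    change (FunctorTensor.tensorFunctor X).map (K.d (n + 1) n) _ = _
    rw [Gr.barComplex_d]
    exact Gr.tensorFunctor_map_barD X A (n + 1) x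
  have hs : ∀ n (x : X.obj (op (Gr.iter A (n + 1)))), Gr.coefD X A n x = 0 →
      Gr.coefD X A (n + 1) (Gr.coefHomotopy A ξ (n + 1) x) = x := by
    intro n x hx
    have h := ConcreteCategory.congr_hom (Gr.coefHomotopy_coefD A h₁ h₂ h₃ n) x
    rw [ConcreteCategory.comp_apply] at h
    refine h.trans ?_
    change x - Gr.coefHomotopy A ξ n (Gr.coefD X A n x) = x
    rw [hx, map_zero, sub_zero]
  have hlift : ∀ n (x : X.obj (op (Gr.iter A (n + 1)))), Gr.coefD X A n x = 0 →
      ∃ y, TK.d (n + 1) n y = FunctorTensor.toTensorStdProj X (Gr.iter A (n + 1)) x :=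
    fun n x hx => ⟨_, (hTK n _).trans (congr_arg _ (hs n x hx))⟩
  cases i with
  | zero =>
    -- Index `0` has no successor, and `next` returns `0` by default. Every element is a cycle, and
    -- `coefD_zero` matches this on the side of `X`.
    rw [HomologicalComplex.exactAt_iff' _ 1 0 0 (by simp) (by simp),
      ShortComplex.moduleCat_exact_iff]
    intro z _
    obtain ⟨x, rfl⟩ := FunctorTensor.toTensorStdProj_surjective X (Gr.iter A 1) z
    refine hlift 0 x ?_
    rw [Gr.coefD_zero]
    rfl
  | succ n =>
    rw [HomologicalComplex.exactAt_iff' _ (n + 2) (n + 1) n (by simp) (by simp),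
      ShortComplex.moduleCat_exact_iff]
    intro z hz
    obtain ⟨x, rfl⟩ := FunctorTensor.toTensorStdProj_surjective X (Gr.iter A (n + 2)) z
    -- Injectivity of the Yoneda map transports the cycle condition back to `X`.
    refine hlift (n + 1) x (FunctorTensor.toTensorStdProj_injective X _ ?_)
    rw [map_zero, ← hTK]
    exact hz
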